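/- Let $1\le k<n$, $m=n-k$ and $L=m^k$. Index the $L$ block rows of every node by their base-$m$ digit vectors $r=(r_1,\dots,r_k)\in(\mathbb Z/m)^k$, and let $P_i$ be the permutation of the rows that adds $1$ modulo $m$ to the digit $r_i$. For a field $F$ and nonzero coefficients $\lambda_{j,i}\in F$, the permutation code has systematic nodes $a_1,\dots,a_k\in F^L$ and parity nodes $p_1,\dots,p_m$ given by $$p_j(r)=\sum_{i=1}^k\lambda_{j,i}\,a_i\big(P_i^{\,j-1}r\big).$$ Its coefficients are chosen so that the code is MDS (the contents of any $k$ nodes determine the data). This is possible, even with $\lambda_{j,i}=\lambda_i^{\,j}$ for nonzero $\lambda_i$, over $\mathrm{GF}(2^w)$ for all sufficiently large $w$. Suppose that systematic node $i$ fails and that the $k-1$ surviving systematic nodes and a set $S$ of $p=|S|\ge1$ parity nodes participate in the repair. The modified two-phase recovery scheme is: (1) download the rows $r$ with $r_i=0$ from all participating nodes; (2) for an arbitrarily chosen $j\in S$, download the rows of parity node $j$ that contain the blocks of $a_i$ that occur in no parity block downloaded in phase (1), and from each surviving systematic node download its components of these parity blocks. Then, for nonzero coefficients $\lambda_{j,i}$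 and for every $i$, every $S$ and every choice of $j$, the downloaded blocks linearly determine $a_i$, and the number of downloaded blocks (the repair bandwidth) is $$\gamma(p)=kL-\frac{L}{n-k}(p-1)(k-1).$$ If $k\ge2$, then $\gamma(p)$ is strictly decreasing in $p$ for $1\le p\le n-k$, and the MDS permutation code with this scheme has the progressive engagement property, that is, with one encoder that does not depend on the number $d$ of participating nodes: the code is an MDS code that encodes the $kL$ data blocks into $(n-k)L$ parity blocks; any lost node can be generated from all $dL$ blocks of any $d$ surviving nodes, $k\le d\le n-1$; for every failed systematic node and every set of $p=d-k+1$ parity nodes, $1\le p\le n-k$, the scheme generates the $L$ missing blocks from at most $dL$ blocks downloaded from the participating nodes; and the average of the repair bandwidth over all sets of $p$ participating parity nodes is strictly decreasing in $p$. -/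

import Mathlib

open Finset

/-- The nodes of a storage system with `k` systematic nodes (`Sum.inl`) and `m` parity nodes
(`Sum.inr`). -/
abbrev StorageNode (k m : ℕ) : Type := Fin k ⊕ Fin m

/-- A systematic linear array code over `F`: every node stores one symbol for each block row in
`B`, so `L = |B|` blocks per node. The encoder turns the `k L` data blocks into `m L` parity
blocks. -/
structure ArrayCode (F : Type*) [Field F] (k m : ℕ) (B : Type*) where
  encode : (Fin k → B → F) →ₗ[F] (Fin m → B → F)

namespace ArrayCode

variable {F : Type*} [Field F] {k m : ℕ} {B : Type*}

/-- The blocks stored in each node when the data is `x`. -/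
def content (C : ArrayCode F k m B) (x : Fin k → B → F) : StorageNode k m → B → F :=
  Sum.elim x (C.encode x)

/-- MDS property: the contents of any `k` of the nodes determine the data. -/
def IsMDS (C : ArrayCode F k m B) : Prop :=
  ∀ T : Finset (StorageNode k m), T.card = k →
    ∀ x y : Fin k → B → F, (∀ v ∈ T, C.content x v = C.content y v) → x = y

/-- The content of node `f` can be generated, by a fixed linear decoder that works for all data,
from the blocks in the rows `D v` of the nodes `v`. -/
def Recovers (C : ArrayCode F k m B) (f : StorageNode k m)
    (D : StorageNode k m → Finset B) : Prop :=
  ∃ dec : ((v : StorageNode k m) → (D v → F)) →ₗ[F] (B → F),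
    ∀ x : Fin k → B → F, dec (fun v b => C.content x v b) = C.content x f

end ArrayCode

/-- A download scheme for the repair of one systematic node: given the failed systematic node and
the set of participating parity nodes, the block rows that are downloaded from each node. -/
abbrev DownloadScheme (k m : ℕ) (B : Type*) : Type _ :=
  Fin k → Finset (Fin m) → StorageNode k m → Finset B

namespace DownloadScheme

variable {k m : ℕ} {B : Type*}

/-- Repair bandwidth: the total number of downloaded blocks. -/
def bandwidth (D : DownloadScheme k m B) (i : Fin k) (S : Finset (Fin m)) : ℕ :=
  ∑ v, (D i S v).card

/-- The average repair bandwidth of node `i` over all sets of `p` participating parity nodes. -/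
def avgBandwidth (D : DownloadScheme k m B) (i : Fin k) (p : ℕ) : ℚ :=
  (∑ S ∈ (univ : Finset (Fin m)).powersetCard p, (D.bandwidth i S : ℚ)) / (m.choose p : ℚ)

/-- The scheme repairs every systematic node with the help of the surviving systematic nodes and
of any nonempty set `S` of parity nodes, downloading nothing from any other node. -/
def IsRepairScheme {F : Type*} [Field F] (D : DownloadScheme k m B)
    (C : ArrayCode F k m B) : Prop :=
  ∀ (i : Fin k) (S : Finset (Fin m)), S.Nonempty →
    D i S (Sum.inl i) = ∅ ∧ (∀ j, j ∉ S → D i S (Sum.inr j) = ∅) ∧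
      C.Recovers (Sum.inl i) (D i S)

end DownloadScheme

/-- Progressive engagement of a code together with its download scheme. The encoder is one fixed
map, which does not depend on the number `d = k - 1 + p` of nodes that take part in a repair. -/
structure ProgressiveEngagement {F : Type*} [Field F] {k m : ℕ} {B : Type*} [Fintype B]
    [DecidableEq B] (C : ArrayCode F k m B) (D : DownloadScheme k m B) : Prop where
  /-- The code is MDS. -/
  mds : C.IsMDS
  /-- With access to all blocks of any `d ≥ k` surviving nodes, any lost node can be generated. -/
  access : ∀ (f : StorageNode k m) (T : Finset (StorageNode k m)), f ∉ T → k ≤ T.card →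
    C.Recovers f (fun v => if v ∈ T then univ else ∅)
  /-- The download scheme repairs every systematic node with any participating parity nodes. -/
  repair : D.IsRepairScheme C
  /-- It uses at most `d L` blocks. -/
  bandwidth_le : ∀ (i : Fin k) (S : Finset (Fin m)), S.Nonempty →
    D.bandwidth i S ≤ (k - 1 + S.card) * Fintype.card B
  /-- Engaging more parity nodes strictly decreases the average repair bandwidth. -/
  avg_lt : ∀ (i : Fin k) (p p' : ℕ), 1 ≤ p → p < p' → p' ≤ m →
    D.avgBandwidth i p' < D.avgBandwidth i p

namespace PermutationCode

/-- The `L = m ^ k` block rows, each written as its vector of `k` digits in base `m`. -/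
abbrev Row (k m : ℕ) : Type := Fin k → Fin m

/-- The `j`-th power of the `i`-th permutation of the block rows: add `j` modulo `m` to the digit
`i` and keep all other digits. -/
def shift {k m : ℕ} (i : Fin k) (j : Fin m) (r : Row k m) : Row k m :=
  Function.update r i (r i + j)

/-- The permutation code with coefficients `lam j i`. Parity nodes are numbered from `0`, so block
row `r` of parity node `j` is the sum over `i` of `lam j i` times the block of systematic node `i`
in the row obtained from `r` by `j` applications of the `i`-th permutation. -/
def code {F : Type*} [Field F] {k m : ℕ} (lam : Fin m → Fin k → F) :
    ArrayCode F k m (Row k m) where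
  encode :=
    { toFun := fun x j r => ∑ i, lam j i * x i (shift i j r)
      map_add' := fun x y => by
        funext j r
        simp [mul_add, Finset.sum_add_distrib]
      map_smul' := fun c x => by
        funext j r
        simp [Finset.mul_sum, mul_left_comm] }

/-- First phase, failed node `i`: the block rows that are downloaded from every participating
node, as in the original scheme with full participation. -/
def phaseOne {k m : ℕ} (i : Fin k) : Finset (Row k m) :=
  univ.filter fun r => (r i : ℕ) = 0

/-- The rows of the failed node `i` whose blocks occur in no first-phase block of a participating
parity node. -/
def missing {k m : ℕ} (i : Fin k) (S : Finset (Fin m)) : Finset (Row k m) :=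
  univ \ S.biUnion fun j => (phaseOne i).image (shift i j)

/-- Second phase: the block rows of the parity node `j` that contain the missing blocks. -/
def phaseTwo {k m : ℕ} (i : Fin k) (S : Finset (Fin m)) (j : Fin m) : Finset (Row k m) :=
  univ.filter fun r => shift i j r ∈ missing i S

/-- The modified two-phase scheme. In the second phase one participating parity node
`c i S` is used, and from each surviving systematic node the components of the downloaded parity
blocks. -/
def twoPhase {k m : ℕ} (c : Fin k → Finset (Fin m) → Fin m) :
    DownloadScheme k m (Row k m) := fun i S v =>
  match v with
  | Sum.inl i' =>
      if i' = i then ∅ else phaseOne i ∪ (phaseTwo i S (c i S)).image (shift i' (c i S))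
  | Sum.inr j =>
      if j ∈ S then
        if j = c i S then phaseOne i ∪ phaseTwo i S j else phaseOne i
      else ∅

end PermutationCode

/-! Repair. A first-phase row of parity node `j` has `i`-th digit 0, so its component from node `i`
has `i`-th digit `j`, while the other components keep digit 0 and are downloaded too. Thus phase one
yields the rows of node `i` whose digit lies in `S`, and phase two the rest (`mem_missing`,
`component_eq_zero`). Each value of a digit occurs in `m ^ (k - 1)` rows, which gives the bandwidth;
it depends on `S` only through `S.card`.

MDS coefficients. The `μ s` are chosen one node at a time, as `y⁻¹`. After rescaling the unknown of
node `s`, each square decoding system is polynomial in `y` and, at `y = 0`, block triangular with a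
smaller decoding system and a permutation on the diagonal. Its determinant is therefore a nonzero
polynomial, so only boundedly many `y` fail (`exists_finset_decodable_update`), and a large field
has a `y` that works for all systems. -/

namespace ArrayCode

/-! ### Linear decoders -/

variable {F : Type*} [Field F] {k m : ℕ} {B : Type*}

theorem content_sub (C : ArrayCode F k m B) (x y : Fin k → B → F) (v : StorageNode k m) :
    C.content (x - y) v = C.content x v - C.content y v := by
  cases v <;> simp [content]

/-- The map that reads off the blocks in the rows `D v` of the nodes `v`. -/
def readOff (C : ArrayCode F k m B) (D : StorageNode k m → Finset B) :
    (Fin k → B → F) →ₗ[F] ((v : StorageNode k m) → (D v → F)) where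
  toFun x v b := C.content x v b
  map_add' x y := by
    funext v b
    cases v <;> simp [content]
  map_smul' c x := by
    funext v b
    cases v <;> simp [content]

/-- The map from the data to the content of one node. -/
def contentMap (C : ArrayCode F k m B) (f : StorageNode k m) :
    (Fin k → B → F) →ₗ[F] (B → F) where
  toFun x := C.content x f
  map_add' x y := by cases f <;> simp [content]
  map_smul' c x := by cases f <;> simp [content]

/-- A linear decoder exists as soon as vanishing of the downloaded blocks forces vanishing of the
content of the failed node. -/
theorem recovers_of_forall_eq_zero (C : ArrayCode F k m B) (f : StorageNode k m)
    (D : StorageNode k m → Finset B)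
    (h : ∀ x, (∀ v, ∀ b ∈ D v, C.content x v b = 0) → C.content x f = 0) :
    C.Recovers f D := by
  have hker : LinearMap.ker (C.readOff D) ≤ LinearMap.ker (C.contentMap f) := by
    intro x hx
    refine h x fun v b hb => ?_
    exact congrFun (congrFun (LinearMap.mem_ker.1 hx) v) ⟨b, hb⟩
  -- The content of `f` factors through the range of `readOff`; over a field, a linear map on a
  -- subspace extends to the whole space.
  obtain ⟨g, hg⟩ := LinearMap.exists_extend
    ((Submodule.liftQ _ (C.contentMap f) hker) ∘ₗ
      (C.readOff D).quotKerEquivRange.symm.toLinearMap)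
  refine ⟨g, fun x => ?_⟩
  have := LinearMap.congr_fun hg (⟨C.readOff D x, x, rfl⟩ : LinearMap.range (C.readOff D))
  have hx : (C.readOff D).quotKerEquivRange.symm ⟨C.readOff D x, x, rfl⟩
      = Submodule.Quotient.mk x := by
    rw [LinearEquiv.symm_apply_eq]
    rfl
  simp only [LinearMap.comp_apply, LinearEquiv.coe_coe, hx] at this
  exact this

/-- In an MDS code, the contents of any `k` or more nodes generate the content of every node. -/
theorem IsMDS.recovers {C : ArrayCode F k m B} [Fintype B] (hC : C.IsMDS)
    (f : StorageNode k m) (T : Finset (StorageNode k m)) (hT : k ≤ T.card) :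
    C.Recovers f (fun v => if v ∈ T then univ else ∅) := by
  refine C.recovers_of_forall_eq_zero f _ fun x hx => ?_
  obtain ⟨U, hUT, hU⟩ := exists_subset_card_eq hT
  have hz : ∀ v, C.content (0 : Fin k → B → F) v = 0 := fun v => by
    simpa using C.content_sub 0 0 v
  have : x = 0 := hC U hU x 0 fun v hv => by
    funext b
    rw [hz]
    exact hx v b (by simp [hUT hv])
  rw [this, hz]

end ArrayCode

/-! ### Digit counts and repair bandwidth -/

namespace PermutationCode

variable {k m : ℕ}

theorem shift_apply_self (i : Fin k) (j : Fin m) (r : Row k m) : shift i j r i = r i + j := by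
  simp [shift]

theorem shift_apply_of_ne {i i' : Fin k} (h : i ≠ i') (j : Fin m) (r : Row k m) :
    shift i' j r i = r i := by
  simp [shift, h]

theorem shift_injective (i : Fin k) (j : Fin m) : Function.Injective (shift i j) := by
  have : NeZero m := ⟨(Fin.pos j).ne'⟩
  intro r s h
  funext a
  have ha := congrFun h a
  by_cases hai : a = i
  · subst hai
    rw [shift_apply_self, shift_apply_self] at ha
    exact add_right_cancel ha
  · rwa [shift_apply_of_ne hai, shift_apply_of_ne hai] at ha

theorem shift_surjective (i : Fin k) (j : Fin m) : Function.Surjective (shift i j) :=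
  Finite.surjective_of_injective (shift_injective i j)

theorem mem_phaseOne {i : Fin k} {r : Row k m} : r ∈ phaseOne i ↔ (r i : ℕ) = 0 := by
  simp [phaseOne]

/-- The missing rows are those whose `i`-th digit is not the number of a participating parity
node. -/
theorem mem_missing {i : Fin k} {S : Finset (Fin m)} {q : Row k m} :
    q ∈ missing i S ↔ q i ∉ S := by
  have : NeZero m := ⟨(Fin.pos (q i)).ne'⟩
  have h0 : ∀ {a : Fin m}, (a : ℕ) = 0 ↔ a = 0 := fun {a} => by
    rw [Fin.ext_iff, Fin.val_zero]
  simp only [missing, mem_sdiff, mem_univ, true_and, mem_biUnion, mem_image, mem_phaseOne, h0,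
    not_iff_not]
  constructor
  · rintro ⟨j, hj, r, hr, rfl⟩
    rwa [shift_apply_self, hr, zero_add]
  · intro hq
    obtain ⟨r, hr⟩ := shift_surjective i (q i) q
    refine ⟨q i, hq, r, ?_, hr⟩
    have := congrFun hr i
    rw [shift_apply_self] at this
    simpa using this

theorem mem_phaseTwo {i : Fin k} {S : Finset (Fin m)} {j : Fin m} {r : Row k m} :
    r ∈ phaseTwo i S j ↔ r i + j ∉ S := by
  simp [phaseTwo, mem_missing, shift_apply_self]

/-- Membership in `phaseTwo i S j` depends only on the `i`-th digit, which `shift i' j` keeps. Hence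
the surviving systematic nodes send the same rows as parity node `j`. -/
theorem image_shift_phaseTwo {i i' : Fin k} (h : i ≠ i') (S : Finset (Fin m)) (j : Fin m) :
    (phaseTwo i S j).image (shift i' j) = phaseTwo i S j := by
  refine eq_of_subset_of_card_le (fun q hq => ?_)
    (card_image_of_injective _ (shift_injective i' j)).ge
  obtain ⟨r, hr, rfl⟩ := mem_image.1 hq
  rw [mem_phaseTwo] at hr ⊢
  rwa [shift_apply_of_ne h]

theorem card_filter_digit_mem (i : Fin k) (A : Finset (Fin m)) :
    (univ.filter fun r : Row k m => r i ∈ A).card = A.card * m ^ (k - 1) := by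
  have : (univ.filter fun r : Row k m => r i ∈ A)
      = Fintype.piFinset (Function.update (fun _ => univ) i A) := by
    ext r
    simp only [mem_filter, mem_univ, true_and, Fintype.mem_piFinset]
    constructor
    · intro h a
      by_cases ha : a = i
      · subst ha
        simpa using h
      · simp [ha]
    · intro h
      simpa using h i
  rw [this, Fintype.card_piFinset, ← mul_prod_erase univ _ (mem_univ i)]
  simp only [Function.update_self]
  congr 1
  rw [prod_congr rfl (g := fun _ => m), prod_const, card_erase_of_mem (mem_univ i)]
  · simp
  · intro a ha
    simp [ne_of_mem_erase ha]

theorem card_phaseOne (hm : 0 < m) (i : Fin k) :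
    (phaseOne i : Finset (Row k m)).card = m ^ (k - 1) := by
  have : NeZero m := ⟨hm.ne'⟩
  have h := card_filter_digit_mem i ({0} : Finset (Fin m))
  rw [card_singleton, one_mul] at h
  rw [← h]
  congr 1
  ext r
  simp [mem_phaseOne]

theorem card_phaseTwo (i : Fin k) (S : Finset (Fin m)) (j : Fin m) :
    (phaseTwo i S j).card = (m - S.card) * m ^ (k - 1) := by
  have e : (phaseTwo i S j).image (shift i j) = univ.filter fun r : Row k m => r i ∈ Sᶜ := by
    ext q
    simp only [mem_image, mem_filter, mem_univ, true_and, mem_compl]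
    constructor
    · rintro ⟨r, hr, rfl⟩
      rw [shift_apply_self]
      exact mem_phaseTwo.1 hr
    · intro hq
      obtain ⟨r, rfl⟩ := shift_surjective i j q
      rw [shift_apply_self] at hq
      exact ⟨r, mem_phaseTwo.2 hq, rfl⟩
  rw [← card_image_of_injective _ (shift_injective i j), e, card_filter_digit_mem, card_compl,
    Fintype.card_fin]

/-- The shift by `j` takes digit 0 to `j ∈ S`, which is not missing. -/
theorem disjoint_phaseOne_phaseTwo (i : Fin k) {S : Finset (Fin m)} {j : Fin m} (hj : j ∈ S) :
    Disjoint (phaseOne i) (phaseTwo i S j) := by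
  have : NeZero m := ⟨(Fin.pos j).ne'⟩
  rw [disjoint_left]
  intro r h1 h2
  rw [mem_phaseOne, ← Fin.val_zero m, ← Fin.ext_iff] at h1
  rw [mem_phaseTwo, h1, zero_add] at h2
  exact h2 hj

theorem card_phaseOne_union_phaseTwo (i : Fin k) {S : Finset (Fin m)} {j : Fin m} (hj : j ∈ S) :
    (phaseOne i ∪ phaseTwo i S j).card = (m - S.card + 1) * m ^ (k - 1) := by
  rw [card_union_of_disjoint (disjoint_phaseOne_phaseTwo i hj), card_phaseOne (Fin.pos j),
    card_phaseTwo]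
  ring

/-- The `k - 1` surviving systematic nodes and the parity node `c i S` send both phases; the other
`S.card - 1` parity nodes send only the first. -/
theorem bandwidth_twoPhase (c : Fin k → Finset (Fin m) → Fin m) (i : Fin k)
    (S : Finset (Fin m)) (hc : c i S ∈ S) :
    (twoPhase c).bandwidth i S =
      k * ((m - S.card + 1) * m ^ (k - 1)) + (S.card - 1) * m ^ (k - 1) := by
  have hsys : ∑ i', (twoPhase c i S (Sum.inl i')).card
      = (k - 1) * ((m - S.card + 1) * m ^ (k - 1)) := by
    rw [← add_sum_erase univ _ (mem_univ i), sum_congr rfl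
      (g := fun _ => (m - S.card + 1) * m ^ (k - 1)), sum_const, card_erase_of_mem (mem_univ i)]
    · simp [twoPhase]
    · intro i' hi'
      have hne := ne_of_mem_erase hi'
      simp only [twoPhase, if_neg hne]
      rw [image_shift_phaseTwo hne.symm, card_phaseOne_union_phaseTwo i hc]
  have hpar : ∑ j, (twoPhase c i S (Sum.inr j)).card
      = (m - S.card + 1) * m ^ (k - 1) + (S.card - 1) * m ^ (k - 1) := by
    rw [← sum_subset (subset_univ S) (fun j _ hj => by simp [twoPhase, hj]),
      ← add_sum_erase S _ hc, sum_congr rfl (g := fun _ => m ^ (k - 1)), sum_const,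
      card_erase_of_mem hc]
    · simp only [twoPhase, hc, if_true, card_phaseOne_union_phaseTwo i hc, smul_eq_mul]
    · intro j hj
      simp [twoPhase, mem_of_mem_erase hj, ne_of_mem_erase hj,
        card_phaseOne (Fin.pos (c i S))]
  rw [DownloadScheme.bandwidth, Fintype.sum_sum_type, hsys, hpar]
  obtain ⟨k, rfl⟩ : ∃ l, k = l + 1 := ⟨k - 1, by have := i.pos; omega⟩
  simp only [Nat.add_sub_cancel]
  ring

/-- The repair bandwidth without subtraction. -/
theorem bandwidth_twoPhase_add (c : Fin k → Finset (Fin m) → Fin m) (i : Fin k)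
    (S : Finset (Fin m)) (hc : c i S ∈ S) :
    (twoPhase c).bandwidth i S + m ^ (k - 1) * ((S.card - 1) * (k - 1)) = k * m ^ k := by
  rw [bandwidth_twoPhase c i S hc]
  have hS : 1 ≤ S.card := card_pos.2 ⟨_, hc⟩
  have hSm : S.card ≤ m := by simpa using card_le_univ S
  obtain ⟨k, rfl⟩ : ∃ l, k = l + 1 := ⟨k - 1, by have := i.pos; omega⟩
  obtain ⟨p, hp⟩ : ∃ p, S.card = p + 1 := ⟨S.card - 1, by omega⟩
  obtain ⟨q, rfl⟩ : ∃ q, m = p + 1 + q := ⟨m - (p + 1), by omega⟩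
  simp only [hp, Nat.add_sub_cancel, Nat.add_sub_cancel_left, pow_succ]
  ring

theorem bandwidth_twoPhase_lt (hk : 2 ≤ k) (c : Fin k → Finset (Fin m) → Fin m) (i : Fin k)
    {S S' : Finset (Fin m)} (hc : c i S ∈ S) (hc' : c i S' ∈ S') (h : S.card < S'.card) :
    (twoPhase c).bandwidth i S' < (twoPhase c).bandwidth i S := by
  have e := bandwidth_twoPhase_add c i S hc
  have e' := bandwidth_twoPhase_add c i S' hc'
  have hS : 1 ≤ S.card := card_pos.2 ⟨_, hc⟩
  have : m ^ (k - 1) * ((S.card - 1) * (k - 1)) < m ^ (k - 1) * ((S'.card - 1) * (k - 1)) :=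
    Nat.mul_lt_mul_of_pos_left
      (Nat.mul_lt_mul_of_pos_right (by omega) (by omega)) (pow_pos (Fin.pos (c i S)) _)
  omega

theorem avgBandwidth_eq (D : DownloadScheme k m (Row k m)) (i : Fin k) {p : ℕ} (hp : p ≤ m)
    {b : ℚ} (h : ∀ S : Finset (Fin m), S.card = p → (D.bandwidth i S : ℚ) = b) :
    D.avgBandwidth i p = b := by
  have hpos : (m.choose p : ℚ) ≠ 0 := by
    exact_mod_cast (Nat.choose_pos hp).ne'
  rw [DownloadScheme.avgBandwidth, sum_congr rfl fun S hS => h S (mem_powersetCard.1 hS).2,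
    sum_const, card_powersetCard, card_univ, Fintype.card_fin, nsmul_eq_mul,
    mul_div_cancel_left₀ _ hpos]

/-- The average is over equal numbers, since the bandwidth depends only on the size of `S`. -/
theorem avgBandwidth_twoPhase (c : Fin k → Finset (Fin m) → Fin m)
    (hc : ∀ i S, S.Nonempty → c i S ∈ S) (i : Fin k) (S : Finset (Fin m)) (hS : S.Nonempty) :
    (twoPhase c).avgBandwidth i S.card = (twoPhase c).bandwidth i S := by
  refine avgBandwidth_eq _ i (by simpa using card_le_univ S) fun S' hS' => ?_
  have hne : S'.Nonempty := card_pos.1 (hS' ▸ card_pos.2 hS)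
  rw [bandwidth_twoPhase c i S (hc i S hS), bandwidth_twoPhase c i S' (hc i S' hne), hS']

/-! ### Correctness of the repair and progressive engagement -/

variable {F : Type*} [Field F]

theorem content_code_inr (lam : Fin m → Fin k → F) (x : Fin k → Row k m → F) (j : Fin m)
    (r : Row k m) :
    (code lam).content x (Sum.inr j) r = ∑ i, lam j i * x i (shift i j r) := rfl

/-- A block of node `i` vanishes if a parity block that contains it and all its other components
vanish. -/
theorem component_eq_zero {lam : Fin m → Fin k → F} (hlam : ∀ j i, lam j i ≠ 0)
    {x : Fin k → Row k m → F} {i : Fin k} {j : Fin m} {r : Row k m}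
    (h : (code lam).content x (Sum.inr j) r = 0)
    (h' : ∀ i', i' ≠ i → x i' (shift i' j r) = 0) : x i (shift i j r) = 0 := by
  rw [content_code_inr, sum_eq_single i (fun i' _ hi' => by rw [h' i' hi', mul_zero])
    (fun hi => (hi (mem_univ i)).elim)] at h
  exact (mul_eq_zero.1 h).resolve_left (hlam j i)

theorem isRepairScheme_twoPhase {lam : Fin m → Fin k → F} (hlam : ∀ j i, lam j i ≠ 0)
    (c : Fin k → Finset (Fin m) → Fin m) (hc : ∀ i S, S.Nonempty → c i S ∈ S) :
    (twoPhase c).IsRepairScheme (code lam) := by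
  intro i S hS
  refine ⟨by simp [twoPhase], fun j hj => by simp [twoPhase, hj],
    ArrayCode.recovers_of_forall_eq_zero _ _ _ fun x hx => ?_⟩
  have hcS := hc i S hS
  have hone : ∀ i', i' ≠ i → ∀ r ∈ phaseOne i, x i' r = 0 := fun i' hi' r hr =>
    hx (Sum.inl i') r (by simp [twoPhase, hi', hr])
  funext q
  change x i q = 0
  by_cases hq : q ∈ missing i S
  · obtain ⟨r, rfl⟩ := shift_surjective i (c i S) q
    have hr : r ∈ phaseTwo i S (c i S) := by simpa [phaseTwo] using hq
    refine component_eq_zero hlam (hx _ r (by simp [twoPhase, hcS, hr])) fun i' hi' => ?_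
    refine hx (Sum.inl i') _ ?_
    simp only [twoPhase, if_neg hi', mem_union]
    exact Or.inr (mem_image_of_mem _ hr)
  · simp only [missing, mem_sdiff, mem_univ, true_and, not_not, mem_biUnion, mem_image] at hq
    obtain ⟨j, hj, r, hr, rfl⟩ := hq
    refine component_eq_zero hlam (hx _ r ?_) fun i' hi' => hone i' hi' _ ?_
    · by_cases hjc : j = c i S
      · subst hjc
        simp [twoPhase, hcS, hr]
      · simp [twoPhase, hj, hjc, hr]
    · rw [mem_phaseOne] at hr ⊢
      rwa [shift_apply_of_ne hi'.symm]

theorem progressiveEngagement_twoPhase (hk : 2 ≤ k) {lam : Fin m → Fin k → F}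
    (hlam : ∀ j i, lam j i ≠ 0) (hmds : (code lam).IsMDS)
    (c : Fin k → Finset (Fin m) → Fin m) (hc : ∀ i S, S.Nonempty → c i S ∈ S) :
    ProgressiveEngagement (code lam) (twoPhase c) where
  mds := hmds
  access f T _ hT := hmds.recovers f T hT
  repair := isRepairScheme_twoPhase hlam c hc
  bandwidth_le i S hS := by
    have e := bandwidth_twoPhase_add c i S (hc i S hS)
    have hS' : 1 ≤ S.card := card_pos.2 hS
    rw [Fintype.card_fun, Fintype.card_fin, Fintype.card_fin]
    -- The bandwidth is at most `k L`, and `k ≤ d` as `S` is nonempty.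
    have : k * m ^ k ≤ (k - 1 + S.card) * m ^ k := Nat.mul_le_mul_right _ (by omega)
    omega
  avg_lt i p p' hp hpp' hp' := by
    have hex : ∀ q ≤ m, ∃ S : Finset (Fin m), S.card = q := fun q hq => by
      obtain ⟨S, -, hS⟩ := exists_subset_card_eq
        (s := (univ : Finset (Fin m))) (n := q) (by simpa using hq)
      exact ⟨S, hS⟩
    obtain ⟨S, rfl⟩ := hex p (hpp'.le.trans hp')
    obtain ⟨S', rfl⟩ := hex p' hp'
    have hS : S.Nonempty := card_pos.1 hp
    have hS' : S'.Nonempty := card_pos.1 (hp.trans hpp'.le)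
    rw [avgBandwidth_twoPhase c hc i S hS, avgBandwidth_twoPhase c hc i S' hS', Nat.cast_lt]
    exact bandwidth_twoPhase_lt hk c i (hc i S hS) (hc i S' hS') hpp'

end PermutationCode

/-! ### Existence of MDS coefficients -/

open Polynomial in
/-- A square matrix of polynomials that is invertible at `0` is invertible at all but boundedly many
points. -/
theorem Matrix.exists_finset_forall_eval_injective {F V : Type*} [Field F] [Fintype V]
    [DecidableEq V] (M : Matrix V V F[X]) (d : ℕ) (hd : ∀ a b, (M a b).natDegree ≤ d)
    (h0 : ∀ v, (M.map (eval 0)).mulVec v = 0 → v = 0) :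
    ∃ Z : Finset F, Z.card ≤ Fintype.card V * d ∧
      ∀ y ∉ Z, ∀ v, (M.map (eval y)).mulVec v = 0 → v = 0 := by
  classical
  have hev : ∀ y, (M.map (eval y)).det = M.det.eval y := fun y =>
    ((evalRingHom y).map_det M).symm
  have hne : M.det ≠ 0 := by
    intro h
    obtain ⟨v, hv, hv'⟩ := Matrix.exists_mulVec_eq_zero_iff.2
      (show (M.map (eval 0)).det = 0 by rw [hev, h, eval_zero])
    exact hv (h0 v hv')
  have hdeg : M.det.natDegree ≤ Fintype.card V * d := by
    rw [Matrix.det_apply]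
    refine natDegree_sum_le_of_forall_le _ _ fun σ _ => (natDegree_smul_le _ _).trans ?_
    refine (natDegree_prod_le _ _).trans ((sum_le_sum fun i _ => hd (σ i) i).trans ?_)
    simp
  refine ⟨M.det.roots.toFinset,
    (Multiset.toFinset_card_le _).trans ((card_roots' _).trans hdeg), fun y hy v hv => ?_⟩
  by_contra hv0
  have := Matrix.exists_mulVec_eq_zero_iff.1 ⟨v, hv0, hv⟩
  rw [hev] at this
  exact hy (by simpa [hne] using this)

namespace PermutationCode

variable {k m : ℕ} {F : Type*} [Field F]

/-- The nodes of `I` can be decoded from the parity nodes of `J` when all other systematic nodes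
are known and the coefficients are `μ i ^ (j + 1)`. -/
def Decodable (m : ℕ) (μ : Fin k → F) (I : Finset (Fin k)) (J : Finset (Fin m)) : Prop :=
  ∀ a : Fin k → Row k m → F,
    (∀ j ∈ J, ∀ r, ∑ i ∈ I, μ i ^ ((j : ℕ) + 1) * a i (shift i j r) = 0) → ∀ i ∈ I, a i = 0

/-- Among `k` accessed nodes there are as many parity nodes as there are systematic nodes left out.
For the difference of two data vectors, the accessed systematic nodes drop out of the parity
equations. -/
theorem isMDS_of_decodable {μ : Fin k → F}
    (h : ∀ (I : Finset (Fin k)) (J : Finset (Fin m)), I.card = J.card → Decodable m μ I J) :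
    (code (fun (j : Fin m) (i : Fin k) => μ i ^ ((j : ℕ) + 1))).IsMDS := by
  intro T hT x y hxy
  rw [← sub_eq_zero]
  set C := code (fun (j : Fin m) (i : Fin k) => μ i ^ ((j : ℕ) + 1))
  have hz : ∀ v ∈ T, C.content (x - y) v = 0 := fun v hv => by
    rw [C.content_sub, hxy v hv, sub_self]
  have hsys : ∀ i, Sum.inl i ∈ T → (x - y) i = 0 := fun i hi => hz _ hi
  have hcard : (T.toLeftᶜ).card = T.toRight.card := by
    have := T.card_toLeft_add_card_toRight
    rw [card_compl, Fintype.card_fin]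
    omega
  funext i
  by_cases hi : Sum.inl i ∈ T
  · exact hsys i hi
  refine h _ _ hcard (x - y) (fun j hj r => ?_) i (by simpa using hi)
  refine Eq.trans ?_ (congrFun (hz _ (mem_toRight.1 hj)) r)
  rw [content_code_inr]
  refine sum_subset (subset_univ _) fun i' _ hi' => ?_
  have : Sum.inl i' ∈ T := by simpa using hi'
  rw [hsys i' this, Pi.zero_apply, mul_zero]

theorem Decodable.congr {μ ν : Fin k → F} {I : Finset (Fin k)} {J : Finset (Fin m)}
    (h : Decodable m μ I J) (hμν : ∀ i ∈ I, μ i = ν i) : Decodable m ν I J := by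
  intro a ha
  refine h a fun j hj r => ?_
  rw [← ha j hj r]
  exact sum_congr rfl fun i hi => by rw [hμν i hi]

section Extend

variable {I : Finset (Fin k)} {J : Finset (Fin m)}

open Polynomial in
/-- The decoding system for the nodes of `I` and parity nodes of `J`, where the coefficient of node
`s` is the inverse of the indeterminate and its column is multiplied by the power `t + 1` of the
indeterminate. -/
noncomputable def scaledSystem (μ : Fin k → F) (s : Fin k) (t : ℕ) (e : I ≃ J) :
    Matrix (I × Row k m) (I × Row k m) F[X] := fun a b =>
  if b.2 = shift (b.1 : Fin k) (e a.1 : Fin m) a.2 then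
    if (b.1 : Fin k) = s then X ^ (t - ((e a.1 : Fin m) : ℕ))
    else C (μ b.1 ^ (((e a.1 : Fin m) : ℕ) + 1))
  else 0

theorem natDegree_scaledSystem_le (μ : Fin k → F) (s : Fin k) (t : ℕ) (e : I ≃ J)
    (a b : I × Row k m) : (scaledSystem μ s t e a b).natDegree ≤ t := by
  unfold scaledSystem
  split_ifs
  · simp
  · simp only [Polynomial.natDegree_C, zero_le]
  · simp

theorem scaledSystem_eval_mulVec (μ : Fin k → F) (s : Fin k) (t : ℕ) (e : I ≃ J) (y : F)
    (v : I × Row k m → F) (i' : I) (r : Row k m) :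
    ((scaledSystem μ s t e).map (Polynomial.eval y)).mulVec v (i', r) =
      ∑ i : I, (if (i : Fin k) = s then y ^ (t - ((e i' : Fin m) : ℕ))
        else μ i ^ (((e i' : Fin m) : ℕ) + 1)) * v (i, shift (i : Fin k) (e i' : Fin m) r) := by
  rw [Matrix.mulVec, dotProduct, Fintype.sum_prod_type]
  refine sum_congr rfl fun i _ => ?_
  rw [sum_eq_single (shift (i : Fin k) (e i' : Fin m) r)]
  · simp only [scaledSystem, Matrix.map_apply, if_true]
    split_ifs <;> simp
  · intro q _ hq
    simp [scaledSystem, hq]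
  · simp

/-- With `t` the largest index in `J`, the factor `y ^ (t + 1)` turns the coefficient `y⁻¹ ^ (j +
1)` into `y ^ (t - j)`, which at `y = 0` survives only for `j = t`. -/
theorem exists_finset_decodable_update (μ : Fin k → F) {s : Fin k} (hs : s ∈ I)
    (hIJ : I.card = J.card)
    (h : ∀ J' : Finset (Fin m), (I.erase s).card = J'.card → Decodable m μ (I.erase s) J') :
    ∃ Z : Finset F, Z.card ≤ k * m ^ k * m ∧
      ∀ y ∉ Z, y ≠ 0 → Decodable m (Function.update μ s y⁻¹) I J := by
  have hJ : J.Nonempty := card_pos.1 (hIJ ▸ card_pos.2 ⟨s, hs⟩)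
  set t : Fin m := J.max' hJ
  have htJ : t ∈ J := J.max'_mem hJ
  have hle : ∀ j ∈ J, (j : ℕ) ≤ t := fun j hj => J.le_max' j hj
  -- Any bijection serves: it only labels the equations by `I`, to make the matrix square.
  have e : I ≃ J := Finset.equivOfCardEq hIJ
  have key : ∀ (y : F) (v : I × Row k m → F) (j : Fin m), j ∈ J → ∀ r,
      ((scaledSystem μ s t e).map (Polynomial.eval y)).mulVec v = 0 →
      ∑ i : I, (if (i : Fin k) = s then y ^ ((t : ℕ) - j) else μ i ^ ((j : ℕ) + 1)) *
        v (i, shift (i : Fin k) j r) = 0 := by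
    intro y v j hj r hv
    have := congrFun hv (e.symm ⟨j, hj⟩, r)
    rw [scaledSystem_eval_mulVec] at this
    simpa using this
  obtain ⟨Z, hZ, hZ'⟩ := Matrix.exists_finset_forall_eval_injective (scaledSystem μ s t e) t
    (natDegree_scaledSystem_le μ s t e) (by
      intro v hv
      let a : Fin k → Row k m → F := fun i q => if hi : i ∈ I then v (⟨i, hi⟩, q) else 0
      have ha : ∀ i : I, ∀ q, v (i, q) = a i q := fun i q => by simp [a]
      have hsum : ∀ j ∈ J, ∀ r, ∑ i ∈ I, (if i = s then (0 : F) ^ ((t : ℕ) - j)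
          else μ i ^ ((j : ℕ) + 1)) * a i (shift i j r) = 0 := by
        intro j hj r
        refine Eq.trans ?_ (key 0 v j hj r hv)
        rw [← sum_coe_sort I]
        exact sum_congr rfl fun i _ => by rw [ha]
      -- At `y = 0` the equations with `j < t` do not involve node `s`, so the smaller system
      -- applies.
      have herase : ∀ i ∈ I.erase s, a i = 0 := by
        refine h (J.erase t) (by rw [card_erase_of_mem hs, card_erase_of_mem htJ, hIJ]) a
          fun j hj r => ?_
        have hjJ := mem_of_mem_erase hj
        have hlt : (j : ℕ) < t :=
          lt_of_le_of_ne (hle j hjJ) fun hjt => ne_of_mem_erase hj (Fin.ext hjt)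
        have := hsum j hjJ r
        rw [← add_sum_erase I _ hs, if_pos rfl, zero_pow (by omega), zero_mul, zero_add] at this
        rw [← this]
        exact sum_congr rfl fun i hi => by rw [if_neg (ne_of_mem_erase hi)]
      -- Equation `t` now reads off node `s` with coefficient 1.
      have has : a s = 0 := by
        funext q
        obtain ⟨r, rfl⟩ := shift_surjective s t q
        have := hsum t htJ r
        rw [← add_sum_erase I _ hs, if_pos rfl, Nat.sub_self, pow_zero, one_mul,
          sum_eq_zero fun i hi => by rw [herase i hi, Pi.zero_apply, mul_zero], add_zero] at this
        exact this
      funext ⟨i, q⟩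
      rw [ha, Pi.zero_apply]
      by_cases hi : (i : Fin k) = s
      · rw [hi, has, Pi.zero_apply]
      · rw [herase i (mem_erase.2 ⟨hi, i.2⟩), Pi.zero_apply])
  refine ⟨Z, hZ.trans ?_, fun y hy hy0 a ha => ?_⟩
  · rw [Fintype.card_prod, Fintype.card_coe, Fintype.card_fun, Fintype.card_fin, Fintype.card_fin]
    have := card_le_univ I
    rw [Fintype.card_fin] at this
    gcongr
    exact t.2.le
  -- Dividing the block of node `s` by `y ^ (t + 1)` compensates for the scaled column.
  have hv := hZ' y hy (fun b => (if (b.1 : Fin k) = s then y⁻¹ ^ ((t : ℕ) + 1) else 1) * a b.1 b.2)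
    (by
      funext ⟨i', r⟩
      rw [scaledSystem_eval_mulVec, Pi.zero_apply, ← ha (e i') (e i').2 r, ← sum_coe_sort I]
      refine sum_congr rfl fun i _ => ?_
      by_cases hi : (i : Fin k) = s
      · simp only [hi, if_true, Function.update_self]
        have hj := hle (e i') (e i').2
        have : ((t : ℕ) + 1) = ((t : ℕ) - ((e i' : Fin m) : ℕ)) + (((e i' : Fin m) : ℕ) + 1) := by
          omega
        rw [← mul_assoc, this, pow_add y⁻¹, ← mul_assoc, ← mul_pow, mul_inv_cancel₀ hy0, one_pow,
          one_mul]
      · simp [hi])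
  intro i hi
  funext q
  have := congrFun hv (⟨i, hi⟩, q)
  simp only [Pi.zero_apply, mul_eq_zero] at this
  refine this.resolve_left ?_
  split_ifs
  · exact pow_ne_zero _ (inv_ne_zero hy0)
  · exact one_ne_zero

end Extend

/-- Nonzero `μ i` that make every square decoding system invertible exist over every field with
sufficiently many elements. -/
theorem exists_forall_decodable [Fintype F]
    (hF : 2 ^ k * 2 ^ m * (k * m ^ k * m) + 1 < Fintype.card F) :
    ∃ μ : Fin k → F, (∀ i, μ i ≠ 0) ∧
      ∀ (I : Finset (Fin k)) (J : Finset (Fin m)), I.card = J.card → Decodable m μ I J := by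
  classical
  suffices ∀ A : Finset (Fin k), ∃ μ : Fin k → F, (∀ i, μ i ≠ 0) ∧
      ∀ I ⊆ A, ∀ J : Finset (Fin m), I.card = J.card → Decodable m μ I J by
    obtain ⟨μ, hμ, h⟩ := this univ
    exact ⟨μ, hμ, fun I => h I (subset_univ I)⟩
  intro A
  induction A using Finset.induction_on with
  | empty =>
    refine ⟨fun _ => 1, fun _ => one_ne_zero, fun I hI J _ a _ i hi => ?_⟩
    exact absurd (hI hi) (notMem_empty i)
  | insert s A hs ih =>
    obtain ⟨μ, hμ, h⟩ := ih
    -- Pairs to which the extension step does not apply get the empty exceptional set.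
    have hex : ∀ IJ : Finset (Fin k) × Finset (Fin m), ∃ Z : Finset F,
        Z.card ≤ k * m ^ k * m ∧ (IJ.1 ⊆ insert s A → s ∈ IJ.1 → IJ.1.card = IJ.2.card →
          ∀ y ∉ Z, y ≠ 0 → Decodable m (Function.update μ s y⁻¹) IJ.1 IJ.2) := by
      rintro ⟨I, J⟩
      by_cases hIJ : I ⊆ insert s A ∧ s ∈ I ∧ I.card = J.card
      · obtain ⟨Z, hZ, hZ'⟩ := exists_finset_decodable_update μ hIJ.2.1 hIJ.2.2
          (h (I.erase s) (by rw [← subset_insert_iff]; exact hIJ.1))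
        exact ⟨Z, hZ, fun _ _ _ => hZ'⟩
      · exact ⟨∅, by simp, fun h1 h2 h3 => (hIJ ⟨h1, h2, h3⟩).elim⟩
    choose Z hZ hZ' using hex
    -- There are `2 ^ k * 2 ^ m` pairs; the extra element is `y = 0`.
    have hcard : (insert 0 (univ.biUnion Z)).card < Fintype.card F := by
      refine lt_of_le_of_lt ((card_insert_le _ _).trans (Nat.add_le_add_right
        (card_biUnion_le_card_mul univ Z _ fun IJ _ => hZ IJ) 1)) ?_
      rw [card_univ, Fintype.card_prod, Fintype.card_finset, Fintype.card_finset,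
        Fintype.card_fin, Fintype.card_fin]
      exact hF
    obtain ⟨y, -, hy⟩ := exists_mem_notMem_of_card_lt_card
      (s := insert 0 (univ.biUnion Z)) (t := univ) (by rwa [card_univ])
    simp only [mem_insert, mem_biUnion, mem_univ, true_and, not_or, not_exists] at hy
    refine ⟨Function.update μ s y⁻¹, fun i => ?_, fun I hI J hIJ => ?_⟩
    · by_cases hi : i = s
      · subst hi
        simpa using hy.1
      · simpa [hi] using hμ i
    · by_cases hsI : s ∈ I
      · exact hZ' (I, J) hI hsI hIJ y (hy.2 _) hy.1
      · refine (h I ((subset_insert_iff_of_notMem hsI).1 hI) J hIJ).congr fun i hi => ?_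
        rw [Function.update_of_ne]
        rintro rfl
        exact hsI hi

theorem exists_isMDS_galoisField (k m : ℕ) :
    ∃ w₀ : ℕ, ∀ w : ℕ, w₀ ≤ w → ∃ μ : Fin k → GaloisField 2 w, (∀ i, μ i ≠ 0) ∧
      (code (fun (j : Fin m) (i : Fin k) => μ i ^ ((j : ℕ) + 1))).IsMDS := by
  -- The bound suffices for `w` itself, since `w < 2 ^ w`; the `+ 1` also excludes `w = 0`.
  refine ⟨2 ^ k * 2 ^ m * (k * m ^ k * m) + 1, fun w hw => ?_⟩
  have := Fintype.ofFinite (GaloisField 2 w)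
  have hc : Fintype.card (GaloisField 2 w) = 2 ^ w := by
    rw [← Nat.card_eq_fintype_card, GaloisField.card 2 w (by omega)]
  obtain ⟨μ, hμ, h⟩ := exists_forall_decodable (k := k) (m := m) (F := GaloisField 2 w)
    (by rw [hc]; exact hw.trans_lt Nat.lt_two_pow_self)
  exact ⟨μ, hμ, isMDS_of_decodable h⟩

end PermutationCode

theorem proposition2 (n k : ℕ) (hk : 1 ≤ k) (hkn : k < n) :
    -- MDS coefficients exist over all large enough fields of `2 ^ w` elements
    (∃ w₀ : ℕ, ∀ w : ℕ, w₀ ≤ w → ∃ μ : Fin k → GaloisField 2 w, (∀ i, μ i ≠ 0) ∧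
      (PermutationCode.code
        (fun (j : Fin (n - k)) (i : Fin k) => μ i ^ ((j : ℕ) + 1))).IsMDS) ∧
    ∀ (F : Type*) [Field F] (lam : Fin (n - k) → Fin k → F), (∀ j i, lam j i ≠ 0) →
    -- every choice of the parity node used in the second phase
    ∀ c : Fin k → Finset (Fin (n - k)) → Fin (n - k), (∀ i S, S.Nonempty → c i S ∈ S) →
      -- the two-phase scheme recovers the failed node, with the stated repair bandwidth
      (PermutationCode.twoPhase c).IsRepairScheme (PermutationCode.code lam) ∧
      (∀ (i : Fin k) (S : Finset (Fin (n - k))), S.Nonempty →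
        ((PermutationCode.twoPhase c).bandwidth i S : ℚ) =
          k * ((n : ℚ) - k) ^ k
            - ((n : ℚ) - k) ^ k / ((n : ℚ) - k) * ((S.card : ℚ) - 1) * ((k : ℚ) - 1)) ∧
      -- for at least two systematic nodes: strict decrease and progressive engagement
      (2 ≤ k →
        (∀ (i : Fin k) (S S' : Finset (Fin (n - k))), S.Nonempty → S.card < S'.card →
          (PermutationCode.twoPhase c).bandwidth i S' <
            (PermutationCode.twoPhase c).bandwidth i S) ∧
        ((PermutationCode.code lam).IsMDS →
          ProgressiveEngagement (PermutationCode.code lam) (PermutationCode.twoPhase c))) := by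
  refine ⟨PermutationCode.exists_isMDS_galoisField k (n - k), fun F _ lam hlam c hc =>
    ⟨PermutationCode.isRepairScheme_twoPhase hlam c hc, fun i S hS => ?_, fun hk2 =>
      ⟨fun i S S' hS h => PermutationCode.bandwidth_twoPhase_lt hk2 c i (hc i S hS)
        (hc i S' (card_pos.1 (Nat.zero_lt_of_lt h))) h,
      fun hmds => PermutationCode.progressiveEngagement_twoPhase hk2 hlam hmds c hc⟩⟩⟩
  have e := congrArg (Nat.cast : ℕ → ℚ)
    (PermutationCode.bandwidth_twoPhase_add c i S (hc i S hS))
  have hS' : 1 ≤ S.card := card_pos.2 hS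
  have hm : (n : ℚ) - k ≠ 0 := sub_ne_zero.2 (by exact_mod_cast hkn.ne')
  push_cast [Nat.cast_sub hS', Nat.cast_sub hk, Nat.cast_sub hkn.le] at e
  -- Here `L / (n - k)` is matched with `m ^ (k - 1)`.
  rw [← e, pow_sub₀ _ hm hk, pow_one]
  ring
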